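/- Let $k$ be an algebraically closed field of characteristic zero, and let $X$ be an algebraic variety over $k$ (a reduced separated scheme of finite type over $k$, not necessarily irreducible; its points are its closed points). Call a positive integer $J$ a Jordan bound for a group $\Gamma$ if every finite subgroup $K$ of $\Gamma$ contains an abelian normal subgroup whose index in $K$ is at most $J$. Let $G$ be a finite subgroup of the group $\mathrm{Aut}(X)$ of $k$-automorphisms of $X$ that has a fixed point $x_0\in X$ lying on every irreducible component of $X$ (if $X$ is irreducible, this just says $X^G\neq\varnothing$). Then the maximum $d=\max_{x\in X}\dim \mathrm{T}_{x,X}$ of the dimensions of the Zariski tangent spaces of $X$ exists, the group $\mathbf{GL}_d(k)$ has a Jordan bound, and for every Jordan bound $J_{\mathbf{GL}_d(k)}$ of $\mathbf{GL}_d(k)$ (in particular the least one) $G$ contains an abelian normal subgroup whose index in $G$ is at most $J_{\mathbf{GL}_d(k)}$. -/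

import Mathlib

open CategoryTheory AlgebraicGeometry

universe u v

/-- An algebraic variety over the field `k`: a reduced separated scheme of finite type over `k`.
It need not be irreducible. -/
structure IsAlgVariety {k : Type u} [Field k] (X : Over (Spec (CommRingCat.of k))) : Prop where
  isReduced : IsReduced X.left
  isSeparated : IsSeparated X.hom
  locallyOfFiniteType : LocallyOfFiniteType X.hom
  quasiCompact : QuasiCompact X.hom

/-- The Zariski tangent space `(𝔪ₓ/𝔪ₓ²)*` of a scheme at a point `x`, a vector space over the
residue field of the local ring at `x` (which is `k` when `x` is a closed point of a variety over
an algebraically closed field `k`). -/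
abbrev ZariskiTangentSpace (X : Scheme.{u}) (x : X) : Type u :=
  Module.Dual (IsLocalRing.ResidueField (X.presheaf.stalk x))
    (IsLocalRing.CotangentSpace (X.presheaf.stalk x))

/-- The dimension of the tangent space at `x`. -/
noncomputable def tangentDim (X : Scheme.{u}) (x : X) : ℕ :=
  Module.finrank (IsLocalRing.ResidueField (X.presheaf.stalk x)) (ZariskiTangentSpace X x)

/-- The group `G` contains an abelian normal subgroup whose index in `G` is finite and
at most `J`. -/
def HasAbelianNormalSubgroupOfIndexLE (G : Type v) [Group G] (J : ℕ) : Prop :=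
  ∃ A : Subgroup G, A.Normal ∧ (∀ a ∈ A, ∀ b ∈ A, a * b = b * a) ∧ A.index ≠ 0 ∧ A.index ≤ J

/-- `J` is a Jordan bound for `Γ`: a positive integer such that every finite subgroup of `Γ`
contains an abelian normal subgroup of index at most `J`. -/
def IsJordanBound (Γ : Type v) [Group Γ] (J : ℕ) : Prop :=
  0 < J ∧ ∀ K : Subgroup Γ, Finite K → HasAbelianNormalSubgroupOfIndexLE K J

/-- A Jordan group. -/
def IsJordanGroup (Γ : Type v) [Group Γ] : Prop :=
  ∃ J : ℕ, IsJordanBound Γ J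

/-- The set `X^G` of fixed points of a group `G` of `k`-automorphisms of `X`, where the points of
a variety over an algebraically closed field are the closed points of the scheme. -/
def fixedClosedPoints {k : Type u} [Field k] (X : Over (Spec (CommRingCat.of k)))
    (G : Subgroup (Aut X)) : Set X.left :=
  {x | IsClosed ({x} : Set X.left) ∧ ∀ g ∈ G, g.hom.left x = x}

/-!
Let `x` be the fixed point, `R` the local ring of `X` at `x` and `𝔪` its maximal ideal. The proof
has three independent ingredients.

*The cotangent representation is faithful.* The morphism `Spec R ⟶ X` is a monomorphism, so each
`g ∈ G` induces a unique `k`-automorphism of `R`. It is dominant, because the generic point of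
every irreducible component specializes to `x`; as `X` is reduced and separated, `g` is determined
by its action on `R` (`exists_injective_stalk_action`). An automorphism `σ` of `R` of finite order
`n` that is trivial on `𝔪/𝔪²` is the identity: if `σ - 1` maps `R` into `𝔪ʲ`, then
`0 = σⁿ - 1 ≡ n (σ - 1)` modulo `𝔪ʲ⁺¹`, hence `σ - 1` maps `R` into every power of `𝔪`
(`eq_id_of_iterate_eq_id`). So `G` acts faithfully on `𝔪/𝔪²`, and adding a trivial representation
embeds `G` in `GL_d(k)`.

*Jordan's theorem* (`exists_jordan_bound`). A finite subgroup of `GL_d(k)` has its entries in a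
finitely generated `ℚ`-algebra, which maps to `ℂ`; inverting finitely many elements keeps the
group embedded, so `k = ℂ` may be assumed. Averaging makes the group unitary. By a lemma of
Frobenius (`commute_of_commute_conj_of_norm_sub_one_lt`) its elements close to the identity
commute, and the subgroup they generate has index bounded by a covering number of the unit ball.

*Tangent spaces have bounded dimension* (`bddAbove_tangentDim`). On an affine open set whose ring of
functions is generated over `k` by `a₁, …, aₙ`, the maximal ideal at a closed point is generated by
the `aᵢ - cᵢ` with `cᵢ ∈ k`, so the tangent space has dimension at most `n`; finitely many such
open sets cover `X`.
-/

/-! ### Finite groups of unitary operators -/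

section

open scoped commutatorElement

open scoped InnerProductSpace in
/-- Frobenius' lemma: if a unitary `A` commutes with its conjugate by a unitary `B` close to `1`,
then it commutes with `B`. Otherwise `A` and `A' = B * A * B⁻¹` have a common eigenvector `v` with
different eigenvalues; then `B⁻¹ v` is an eigenvector of `A` for the eigenvalue of `A'` at `v`, so
it is orthogonal to `v`, and `B` moves it too far. -/
theorem commute_of_commute_conj_of_norm_sub_one_lt {E : Type*} [NormedAddCommGroup E]
    [InnerProductSpace ℂ E] [FiniteDimensional ℂ E] {A B : unitary (E →L[ℂ] E)}
    (hcomm : Commute A (B * A * B⁻¹)) (hB : ‖(B : E →L[ℂ] E) - 1‖ < 1) : Commute A B := by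
  have : CompleteSpace E := FiniteDimensional.complete ℂ E
  set A' := B * A * B⁻¹ with hA'
  suffices h : A = A' by
    have : A' * B = B * A := by rw [hA']; group
    rw [← h] at this
    exact this
  by_contra hne
  set D : E →L[ℂ] E := (A : E →L[ℂ] E) - A' with hD
  have hD0 : D ≠ 0 := fun h => hne (Subtype.ext (sub_eq_zero.mp h))
  have hc : Commute (A : E →L[ℂ] E) A' := congrArg Subtype.val hcomm
  have hc1 : Commute (A : E →L[ℂ] E) (star (A' : E →L[ℂ] E)) :=
    congrArg Subtype.val (hcomm.inv_right)
  have hc2 : Commute (star (A : E →L[ℂ] E)) (A' : E →L[ℂ] E) :=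
    congrArg Subtype.val (hcomm.inv_left)
  have hc3 : Commute (star (A : E →L[ℂ] E)) (A : E →L[ℂ] E) :=
    congrArg Subtype.val ((Commute.refl A).inv_left)
  have hc4 : Commute (star (A' : E →L[ℂ] E)) (A' : E →L[ℂ] E) :=
    congrArg Subtype.val ((Commute.refl A').inv_left)
  have hnormal : IsStarNormal D := by
    refine ⟨?_⟩
    rw [hD, star_sub]
    exact (hc3.sub_left hc1.symm).sub_right (hc2.sub_left hc4)
  have : Nontrivial (E →L[ℂ] E) := ⟨⟨_, _, hD0⟩⟩
  -- The spectral radius of the normal operator `D` is its norm, so `D` has a nonzero eigenvalue.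
  obtain ⟨ν, hν, hνD⟩ := spectrum.exists_nnnorm_eq_spectralRadius D
  rw [hnormal.spectralRadius_eq_nnnorm] at hνD
  have hν0 : ν ≠ 0 := by
    rintro rfl
    apply hD0
    rw [nnnorm_zero, ENNReal.coe_zero, eq_comm, ENNReal.coe_eq_zero, nnnorm_eq_zero] at hνD
    exact hνD
  have hev : Module.End.HasEigenvalue (D : E →ₗ[ℂ] E) ν := by
    rw [Module.End.hasEigenvalue_iff_mem_spectrum]
    rw [← AlgEquiv.spectrum_eq (Module.End.toContinuousLinearMap E)]
    exact hν
  have hcD : Commute (D : E →ₗ[ℂ] E) ((A : E →L[ℂ] E) : E →ₗ[ℂ] E) := by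
    have : Commute D (A : E →L[ℂ] E) := (Commute.refl _).sub_left hc.symm
    exact congrArg ContinuousLinearMap.toLinearMap this
  obtain ⟨μ, v, hv0, hvA, hvD⟩ : ∃ μ : ℂ, ∃ v : E, v ≠ 0 ∧ (A : E →L[ℂ] E) v = μ • v ∧
      D v = ν • v := by
    have hmaps := Module.End.mapsTo_genEigenspace_of_comm hcD ν 1
    have : Nontrivial (Module.End.eigenspace (D : E →ₗ[ℂ] E) ν) :=
      (Submodule.nontrivial_iff_ne_bot).mpr hev
    obtain ⟨μ, hμ⟩ := Module.End.exists_eigenvalue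
      (((A : E →L[ℂ] E) : E →ₗ[ℂ] E).restrict hmaps)
    obtain ⟨⟨v, hvmem⟩, hv⟩ := hμ.exists_hasEigenvector
    refine ⟨μ, v, fun h => hv.2 (Subtype.ext h), ?_, ?_⟩
    · exact congrArg Subtype.val hv.apply_eq_smul
    · exact Module.End.mem_eigenspace_iff.mp hvmem
  have hvA' : (A' : E →L[ℂ] E) v = (μ - ν) • v := by
    have : (A : E →L[ℂ] E) v - (A' : E →L[ℂ] E) v = ν • v := hvD
    rw [sub_smul, ← hvA, ← this]
    abel
  set w : E := ((B⁻¹ : unitary (E →L[ℂ] E)) : E →L[ℂ] E) v with hw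
  have hBw : (B : E →L[ℂ] E) w = v := by
    have : B * B⁻¹ = 1 := mul_inv_cancel B
    exact congrArg (fun T : unitary (E →L[ℂ] E) => (T : E →L[ℂ] E) v) this
  have hwA : (A : E →L[ℂ] E) w = (μ - ν) • w := by
    have : A * B⁻¹ = B⁻¹ * A' := by rw [hA']; group
    have := congrArg (fun T : unitary (E →L[ℂ] E) => (T : E →L[ℂ] E) v) this
    rw [hw, ← map_smul, ← hvA']
    exact this
  have hnorm : ‖w‖ = ‖v‖ := by
    rw [← hBw]
    exact (ContinuousLinearMap.norm_map_of_mem_unitary B.2 w).symm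
  have hvpos : 0 < ‖v‖ := norm_pos_iff.mpr hv0
  have hinner : ⟪w, v⟫_ℂ = 0 := by
    have h1 := ContinuousLinearMap.inner_map_map_of_mem_unitary A.2 w v
    have h2 := ContinuousLinearMap.inner_map_map_of_mem_unitary A.2 w w
    rw [hwA, hvA, inner_smul_left, inner_smul_right] at h1
    rw [hwA, inner_smul_left, inner_smul_right] at h2
    have hww : ⟪w, w⟫_ℂ ≠ 0 := by
      rw [inner_self_ne_zero, ← norm_pos_iff, hnorm]
      exact hvpos
    have h3 : (starRingEnd ℂ) (μ - ν) * (μ - ν) = 1 :=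
      mul_right_cancel₀ hww (by linear_combination h2)
    have h4 : (starRingEnd ℂ) (μ - ν) * ν * ⟪w, v⟫_ℂ = 0 := by
      linear_combination h1 - h3 * ⟪w, v⟫_ℂ
    have h5 : (starRingEnd ℂ) (μ - ν) ≠ 0 := left_ne_zero_of_mul_eq_one h3
    exact (mul_eq_zero.mp h4).resolve_left (mul_ne_zero h5 hν0)
  have hlt : ‖v - w‖ < ‖v‖ := by
    calc ‖v - w‖ = ‖((B : E →L[ℂ] E) - 1) w‖ := by
          rw [sub_apply, hBw]; rfl
      _ ≤ ‖(B : E →L[ℂ] E) - 1‖ * ‖w‖ := ContinuousLinearMap.le_opNorm _ _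
      _ < 1 * ‖w‖ := by
          apply mul_lt_mul_of_pos_right hB
          rw [hnorm]; exact hvpos
      _ = ‖v‖ := by rw [one_mul, hnorm]
  have hpyth : ‖v - w‖ * ‖v - w‖ = ‖v‖ * ‖v‖ + ‖w‖ * ‖w‖ := by
    rw [@norm_sub_mul_self ℂ, inner_eq_zero_symm.mp hinner]
    simp
  rw [hnorm] at hpyth
  nlinarith [norm_nonneg (v - w)]

theorem norm_commutatorElement_sub_one_le {A : Type*} [CStarAlgebra A] (U V : unitary A) :
    ‖((⁅U, V⁆ : unitary A) : A) - 1‖ ≤ 2 * ‖(U : A) - 1‖ * ‖(V : A) - 1‖ := by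
  have h : ((⁅U, V⁆ : unitary A) : A) - 1 =
      (((U : A) - 1) * ((V : A) - 1) - ((V : A) - 1) * ((U : A) - 1)) *
        (((V * U)⁻¹ : unitary A) : A) := by
    have h1 : ((⁅U, V⁆ : unitary A) : A) = (U : A) * V * (((V * U)⁻¹ : unitary A) : A) := by
      have : ⁅U, V⁆ = U * V * (V * U)⁻¹ := by rw [commutatorElement_def]; group
      rw [this]; rfl
    have h2 : (1 : A) = (V : A) * U * (((V * U)⁻¹ : unitary A) : A) :=
      (congrArg Subtype.val (mul_inv_cancel (V * U))).symm
    have h3 : ((U : A) - 1) * ((V : A) - 1) - ((V : A) - 1) * ((U : A) - 1)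
        = (U : A) * V - V * U := by noncomm_ring
    rw [h3, sub_mul, ← h1, ← h2]
  rw [h, CStarRing.norm_mul_coe_unitary]
  calc _ ≤ ‖((U : A) - 1) * ((V : A) - 1)‖ + ‖((V : A) - 1) * ((U : A) - 1)‖ := norm_sub_le _ _
    _ ≤ ‖(U : A) - 1‖ * ‖(V : A) - 1‖ + ‖(V : A) - 1‖ * ‖(U : A) - 1‖ :=
        add_le_add (norm_mul_le _ _) (norm_mul_le _ _)
    _ = _ := by ring

/-- Near the identity a finite group of unitary operators is commutative: the iterated commutators
`⁅a, ⁅a, … ⁅a, b⁆⁆⁆` shrink to `1`, hence are eventually equal to `1`, and Frobenius' lemma removes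
the outermost commutator as long as the inner ones are close to `1`. -/
theorem commute_of_norm_sub_one_le {E : Type*} [NormedAddCommGroup E]
    [InnerProductSpace ℂ E] [FiniteDimensional ℂ E] {G : Type*} [Group G] [Finite G]
    {ρ : G →* unitary (E →L[ℂ] E)} (hρ : Function.Injective ρ) {a b : G}
    (ha : ‖(ρ a : E →L[ℂ] E) - 1‖ ≤ 1 / 4) (hb : ‖(ρ b : E →L[ℂ] E) - 1‖ ≤ 1 / 4) :
    Commute a b := by
  have : CompleteSpace E := FiniteDimensional.complete ℂ E
  let c : ℕ → G := fun n => (fun x => ⁅a, x⁆)^[n] b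
  have hc_succ (n : ℕ) : c (n + 1) = ⁅a, c n⁆ := Function.iterate_succ_apply' _ _ _
  have hc (n : ℕ) : ‖(ρ (c n) : E →L[ℂ] E) - 1‖ ≤ 1 / 4 * (1 / 2) ^ n := by
    induction n with
    | zero => simpa [c] using hb
    | succ n ih =>
      rw [hc_succ, map_commutatorElement]
      refine (norm_commutatorElement_sub_one_le _ _).trans ?_
      calc _ ≤ 2 * (1 / 4) * (1 / 4 * (1 / 2 : ℝ) ^ n) := by gcongr
        _ = _ := by ring
  -- Only finitely many distances to `1` occur in `G`, so a sequence tending to `1` reaches it.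
  have hex : ∃ n, c n = 1 := by
    have hfin : (Set.range fun g : G => ‖(ρ g : E →L[ℂ] E) - 1‖).Finite := Set.finite_range _
    have hlim : Filter.Tendsto (fun n => ‖(ρ (c n) : E →L[ℂ] E) - 1‖) Filter.atTop (nhds 0) := by
      refine squeeze_zero (fun _ => norm_nonneg _) hc ?_
      simpa only [mul_zero] using (tendsto_pow_atTop_nhds_zero_of_lt_one (r := (1 / 2 : ℝ))
        (by norm_num) (by norm_num)).const_mul (1 / 4)
    have hopen : IsOpen ((Set.range fun g : G => ‖(ρ g : E →L[ℂ] E) - 1‖) \ {0})ᶜ :=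
      (hfin.subset Set.sdiff_subset).isClosed.isOpen_compl
    obtain ⟨n, hn⟩ := (hlim.eventually (hopen.mem_nhds (by simp))).exists
    refine ⟨n, hρ (Subtype.ext ?_)⟩
    have : ‖(ρ (c n) : E →L[ℂ] E) - 1‖ = 0 := by
      by_contra h
      exact hn ⟨⟨c n, rfl⟩, h⟩
    rw [map_one]
    exact sub_eq_zero.mp (norm_eq_zero.mp this)
  have hstep (n : ℕ) (h : Commute a (c (n + 1))) : Commute a (c n) := by
    have h1 : Commute (ρ a) (ρ (c n) * ρ a * (ρ (c n))⁻¹) := by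
      have : c n * a * (c n)⁻¹ = (c (n + 1))⁻¹ * a := by
        rw [hc_succ, commutatorElement_def]; group
      rw [← map_inv, ← map_mul, ← map_mul, this]
      exact (h.inv_right.mul_right (Commute.refl a)).map ρ
    have h2 := commute_of_commute_conj_of_norm_sub_one_lt h1 (lt_of_le_of_lt (hc n) (by
      have : (1 / 2 : ℝ) ^ n ≤ 1 := pow_le_one₀ (by norm_num) (by norm_num)
      linarith))
    exact hρ (by simpa using h2.eq)
  obtain ⟨n, hn⟩ := hex
  have hzero (n : ℕ) : Commute a (c n) → Commute a (c 0) := by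
    induction n with
    | zero => exact id
    | succ n ih => exact fun h => ih (hstep n h)
  exact hzero n (hn ▸ Commute.one_right a)

/-- The elements within `1 / 4` of the identity generate an abelian subgroup; representatives of
its cosets are `1 / 4`-separated, so their number is bounded by a covering number of the
unit ball. -/
theorem exists_abelian_subgroup_index_le_of_unitary (E : Type*) [NormedAddCommGroup E]
    [InnerProductSpace ℂ E] [FiniteDimensional ℂ E] :
    ∃ J : ℕ, ∀ (G : Type v) [Group G] [Finite G] (ρ : G →* unitary (E →L[ℂ] E)),
      Function.Injective ρ →
        ∃ H : Subgroup G, (∀ a ∈ H, ∀ b ∈ H, a * b = b * a) ∧ H.index ≤ J := by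
  have : CompleteSpace E := FiniteDimensional.complete ℂ E
  have : ProperSpace (E →L[ℂ] E) := FiniteDimensional.proper ℂ _
  obtain ⟨t, -, ht, hcover⟩ := totallyBounded_iff_subset.mp
    (isCompact_closedBall (0 : E →L[ℂ] E) 1).totallyBounded _
      (Metric.dist_mem_uniformity (show (0 : ℝ) < 1 / 8 by norm_num))
  refine ⟨t.ncard, fun G _ _ ρ hρ => ?_⟩
  have hex (g : G) : ∃ y ∈ t, dist (ρ g : E →L[ℂ] E) y < 1 / 8 := by
    have : (ρ g : E →L[ℂ] E) ∈ Metric.closedBall (0 : E →L[ℂ] E) 1 := by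
      rw [mem_closedBall_zero_iff]
      exact ContinuousLinearMap.opNorm_le_bound _ zero_le_one fun x => by
        rw [ContinuousLinearMap.norm_map_of_mem_unitary (ρ g).2, one_mul]
    simpa using hcover this
  choose f hft hf using hex
  let s : Set G := {g | ‖(ρ g : E →L[ℂ] E) - 1‖ ≤ 1 / 4}
  refine ⟨Subgroup.closure s, fun a ha b hb => ?_, ?_⟩
  · have h : Subgroup.closure s ≤ Subgroup.centralizer (Subgroup.closure s) := by
      rw [Subgroup.centralizer_closure, Subgroup.closure_le]
      intro x hx
      rw [SetLike.mem_coe, Subgroup.mem_centralizer_iff]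
      exact fun y hy => (commute_of_norm_sub_one_le hρ hy hx).eq
    exact Subgroup.mem_centralizer_iff.mp (h hb) a ha
  · have : Finite t := ht
    rw [Subgroup.index, ← Nat.card_coe_set_eq t]
    refine Nat.card_le_card_of_injective
      (fun q : G ⧸ Subgroup.closure s => (⟨f q.out, hft _⟩ : t)) ?_
    intro p q hpq
    rw [← p.out_eq', ← q.out_eq', QuotientGroup.eq]
    refine Subgroup.subset_closure ?_
    have hfeq : f p.out = f q.out := congrArg Subtype.val hpq
    have h1 : dist (ρ q.out : E →L[ℂ] E) (ρ p.out) ≤ 1 / 4 := by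
      calc _ ≤ dist (ρ q.out : E →L[ℂ] E) (f q.out) + dist (ρ p.out : E →L[ℂ] E) (f q.out) :=
            dist_triangle_right _ _ _
        _ ≤ 1 / 8 + 1 / 8 := add_le_add (hf _).le (hfeq ▸ (hf p.out).le)
        _ = 1 / 4 := by norm_num
    have h2 : (ρ (p.out⁻¹ * q.out) : E →L[ℂ] E) - 1 =
        ((ρ p.out)⁻¹ : unitary (E →L[ℂ] E)) * ((ρ q.out : E →L[ℂ] E) - ρ p.out) := by
      rw [mul_sub, map_mul, map_inv]
      congr 1
      exact (congrArg Subtype.val (inv_mul_cancel (ρ p.out))).symm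
    change ‖(ρ (p.out⁻¹ * q.out) : E →L[ℂ] E) - 1‖ ≤ 1 / 4
    rw [h2, CStarRing.norm_coe_unitary_mul, ← dist_eq_norm]
    exact h1

end

/-! ### Jordan's theorem in characteristic zero -/

/-- The normal core of a subgroup of index `n` is the kernel of the action on its `n` cosets, so its
index divides `n!`. -/
theorem hasAbelianNormalSubgroupOfIndexLE_factorial {G : Type v} [Group G] [Finite G]
    {H : Subgroup G} (hH : ∀ a ∈ H, ∀ b ∈ H, a * b = b * a) {J : ℕ} (hJ : H.index ≤ J) :
    HasAbelianNormalSubgroupOfIndexLE G J.factorial := by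
  have hle := H.normalCore_le
  refine ⟨H.normalCore, H.normalCore_normal, fun a ha b hb => hH a (hle ha) b (hle hb),
    Subgroup.index_ne_zero_of_finite, ?_⟩
  refine le_trans (Nat.le_of_dvd (Nat.factorial_pos _) ?_) (Nat.factorial_le hJ)
  rw [Subgroup.normalCore_eq_ker, Subgroup.index_ker, Subgroup.index_eq_card, ← Nat.card_perm]
  exact Subgroup.card_subgroup_dvd_card _

theorem HasAbelianNormalSubgroupOfIndexLE.of_mulEquiv {G : Type u} {H : Type v} [Group G]
    [Group H] (e : G ≃* H) {J : ℕ} (h : HasAbelianNormalSubgroupOfIndexLE G J) :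
    HasAbelianNormalSubgroupOfIndexLE H J := by
  obtain ⟨A, hA, hcomm, h0, hle⟩ := h
  refine ⟨A.map e.toMonoidHom, hA.map _ e.surjective, ?_, ?_, ?_⟩
  · rintro _ ⟨a, ha, rfl⟩ _ ⟨b, hb, rfl⟩
    rw [← map_mul, ← map_mul, hcomm a ha b hb]
  · exact (Subgroup.index_map_equiv A e).trans_ne h0
  · exact (Subgroup.index_map_equiv A e).trans_le hle

/-- A finite group of invertible elements of a C⋆-algebra is conjugate to a group of unitaries:
conjugate by the square root of the average `∑ g, ρ(g)⋆ ρ(g)`. -/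
theorem exists_unitary_conj {A : Type*} [CStarAlgebra A] [PartialOrder A] [StarOrderedRing A]
    {G : Type*} [Group G] [Finite G] (ρ : G →* A) :
    ∃ (S : Aˣ) (U : G →* unitary A), ∀ g, (U g : A) = S * ρ g * (S⁻¹ : Aˣ) := by
  classical
  have := Fintype.ofFinite G
  set P : A := ∑ g, star (ρ g) * ρ g with hP
  have hP1 : 1 ≤ P := by
    calc (1 : A) = star (ρ 1) * ρ 1 := by simp
      _ ≤ P := Finset.single_le_sum (f := fun g => star (ρ g) * ρ g)
        (fun g _ => star_mul_self_nonneg (ρ g)) (Finset.mem_univ 1)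
  have hPinv (g : G) : star (ρ g) * P * ρ g = P := by
    rw [hP, Finset.mul_sum, Finset.sum_mul]
    refine Fintype.sum_equiv (Equiv.mulRight g) _ _ fun h => ?_
    simp [mul_assoc]
  have hP0 : 0 ≤ P := zero_le_one.trans hP1
  have hPunit : IsUnit P := CStarAlgebra.isUnit_of_le 1 hP1
  have hSS : CFC.sqrt P * CFC.sqrt P = P := CFC.sqrt_mul_sqrt_self P
  have hS : IsUnit (CFC.sqrt P) := (CFC.isUnit_sqrt_iff P hP0).mpr hPunit
  have hstar : star (CFC.sqrt P) = CFC.sqrt P := (CFC.sqrt_nonneg P).isSelfAdjoint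
  obtain ⟨S, hSeq⟩ := hS
  rw [← hSeq] at hSS hstar
  have hstarinv : star ((S⁻¹ : Aˣ) : A) = (S⁻¹ : Aˣ) := by
    rw [← Units.coe_star_inv, show star S = S from Units.ext hstar]
  let V : G →* A :=
    { toFun g := S * ρ g * (S⁻¹ : Aˣ)
      map_one' := by simp
      map_mul' g h := by simp [mul_assoc] }
  have hV1 (g : G) : star (V g) * V g = 1 := by
    change star ((S : A) * ρ g * (S⁻¹ : Aˣ)) * (S * ρ g * (S⁻¹ : Aˣ)) = 1
    rw [star_mul, star_mul, hstar, hstarinv]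
    calc _ = ((S⁻¹ : Aˣ) : A) * (star (ρ g) * ((S : A) * S) * ρ g) * (S⁻¹ : Aˣ) := by noncomm_ring
      _ = ((S⁻¹ : Aˣ) : A) * ((S : A) * S) * (S⁻¹ : Aˣ) := by rw [hSS, hPinv]
      _ = 1 := by simp
  have hV2 (g : G) : V g * star (V g) = 1 := by
    have h1 : V g * V g⁻¹ = 1 := by rw [← map_mul]; simp
    rw [left_inv_eq_right_inv (hV1 g) h1, h1]
  exact ⟨S, V.codRestrict (unitary A) fun g => ⟨hV1 g, hV2 g⟩, fun g => rfl⟩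

/-- Jordan's theorem over `ℂ`. The bound depends only on `d`. -/
theorem exists_jordan_bound_complex (d : ℕ) :
    ∃ J : ℕ, 0 < J ∧ ∀ (G : Type v) [Group G] [Finite G] (ρ : G →* Matrix (Fin d) (Fin d) ℂ),
      Function.Injective ρ → HasAbelianNormalSubgroupOfIndexLE G J := by
  obtain ⟨J, hJ⟩ := exists_abelian_subgroup_index_le_of_unitary.{v} (EuclideanSpace ℂ (Fin d))
  refine ⟨J.factorial, J.factorial_pos, fun G _ _ ρ hρ => ?_⟩
  obtain ⟨S, U, hU⟩ := exists_unitary_conj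
    (((MonoidHomClass.toMonoidHom (Matrix.toEuclideanCLM (n := Fin d) (𝕜 := ℂ))).comp ρ))
  obtain ⟨H, hH, hindex⟩ := hJ G U fun g h hgh => by
    have := congrArg Subtype.val hgh
    rw [hU, hU, Units.mul_left_inj, Units.mul_right_inj] at this
    exact hρ (Matrix.toEuclideanCLM (n := Fin d) (𝕜 := ℂ).injective this)
  exact hasAbelianNormalSubgroupOfIndexLE_factorial hH hindex

/-- The quotient of a finitely generated `ℚ`-algebra by a maximal ideal is a number field, by
Zariski's lemma. -/
theorem nonempty_ringHom_complex (R : Type*) [CommRing R] [Nontrivial R] [Algebra ℚ R]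
    [Algebra.FiniteType ℚ R] : Nonempty (R →+* ℂ) := by
  obtain ⟨m, hm⟩ := Ideal.exists_maximal R
  let := Ideal.Quotient.field m
  have : Module.Finite ℚ (R ⧸ m) := finite_of_finite_type_of_isJacobsonRing ℚ (R ⧸ m)
  exact ⟨((IsAlgClosed.lift : (R ⧸ m) →ₐ[ℚ] ℂ) : (R ⧸ m) →+* ℂ).comp (Ideal.Quotient.mk m)⟩

theorem exists_subring_ringHom_complex {k : Type u} [Field k] [CharZero k] {s : Set k}
    (hs : s.Finite) : ∃ R : Subring k, s ⊆ R ∧ Nonempty (R →+* ℂ) := by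
  have : Algebra.FiniteType ℚ (Algebra.adjoin ℚ s) :=
    (Algebra.adjoin ℚ s).fg_iff_finiteType.mp ⟨hs.toFinset, by simp⟩
  exact ⟨(Algebra.adjoin ℚ s).toSubring, Algebra.subset_adjoin,
    nonempty_ringHom_complex (Algebra.adjoin ℚ s)⟩

/-- Jordan's theorem over a field of characteristic zero. The entries of the group are moved to `ℂ`
by a homomorphism that need not be injective; adjoining the inverses of the nonzero entries of all
`ρ g - 1` to its domain ensures that it stays injective on the group. -/
theorem exists_jordan_bound (k : Type u) [Field k] [CharZero k] (d : ℕ) :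
    ∃ J : ℕ, 0 < J ∧ ∀ (G : Type v) [Group G] [Finite G] (ρ : G →* Matrix (Fin d) (Fin d) k),
      Function.Injective ρ → HasAbelianNormalSubgroupOfIndexLE G J := by
  obtain ⟨J, hJ0, hJ⟩ := exists_jordan_bound_complex.{v} d
  refine ⟨J, hJ0, fun G _ _ ρ hρ => ?_⟩
  let entry : G × Fin d × Fin d → k := fun p => ρ p.1 p.2.1 p.2.2
  let entryInv : G × Fin d × Fin d → k := fun p =>
    (ρ p.1 p.2.1 p.2.2 - (1 : Matrix _ _ k) p.2.1 p.2.2)⁻¹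
  let s : Set k := Set.range entry ∪ Set.range entryInv
  have hs : s.Finite := (Set.finite_range _).union (Set.finite_range _)
  obtain ⟨R, hsR, ⟨φ⟩⟩ := exists_subring_ringHom_complex hs
  let ρR : G →* Matrix (Fin d) (Fin d) R :=
    { toFun g := Matrix.of fun i j => ⟨ρ g i j, hsR (.inl ⟨(g, i, j), rfl⟩)⟩
      map_one' := by
        ext i j
        simp [Matrix.one_apply, apply_ite]
      map_mul' g h := by
        ext i j
        simp [Matrix.mul_apply] }
  refine hJ G ((MonoidHomClass.toMonoidHom φ.mapMatrix).comp ρR)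
    ((injective_iff_map_eq_one _).mpr fun g hg => ?_)
  refine hρ ?_
  rw [map_one]
  ext i j
  by_contra hne
  let x : R := ⟨ρ g i j - (1 : Matrix _ _ k) i j, by
    refine sub_mem (hsR (.inl ⟨(g, i, j), rfl⟩)) ?_
    rw [Matrix.one_apply]
    split_ifs
    exacts [one_mem _, zero_mem _]⟩
  let y : R :=
    ⟨(ρ g i j - (1 : Matrix _ _ k) i j)⁻¹, hsR (.inr ⟨(g, i, j), rfl⟩)⟩
  have hxy : x * y = 1 := Subtype.ext (mul_inv_cancel₀ (sub_ne_zero.mpr hne))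
  have hx : φ x = 0 := by
    have h1 := congrFun (congrFun hg i) j
    have h2 : x = ρR g i j - (1 : Matrix _ _ R) i j := by
      refine Subtype.ext ?_
      change ρ g i j - (1 : Matrix _ _ k) i j = ρ g i j - ((1 : Matrix (Fin d) (Fin d) R) i j : R)
      rw [Matrix.one_apply, Matrix.one_apply]
      split_ifs <;> rfl
    rw [h2, map_sub, sub_eq_zero]
    rw [Matrix.one_apply] at h1 ⊢
    rw [apply_ite φ, map_one, map_zero]
    exact h1
  simpa [hx] using congrArg φ hxy

theorem isJordanGroup_generalLinearGroup (k : Type u) [Field k] [CharZero k] (d : ℕ) :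
    IsJordanGroup (Matrix.GeneralLinearGroup (Fin d) k) := by
  obtain ⟨J, hJ0, hJ⟩ := exists_jordan_bound.{u, u} k d
  exact ⟨J, hJ0, fun K _ => hJ K ((Units.coeHom _).comp K.subtype)
    (Units.val_injective.comp Subtype.val_injective)⟩

theorem IsJordanBound.of_injective_matrix {k : Type u} [Field k] {d J : ℕ}
    (hJ : IsJordanBound (Matrix.GeneralLinearGroup (Fin d) k) J) {G : Type v} [Group G] [Finite G]
    (τ : G →* Matrix (Fin d) (Fin d) k) (hτ : Function.Injective τ) :
    HasAbelianNormalSubgroupOfIndexLE G J := by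
  have hinj : Function.Injective τ.toHomUnits := fun g h hgh => hτ (congrArg Units.val hgh)
  have : Finite τ.toHomUnits.range := Finite.of_surjective _ τ.toHomUnits.rangeRestrict_surjective
  exact (hJ.2 τ.toHomUnits.range this).of_mulEquiv (MonoidHom.ofInjective hinj).symm

section

open IsLocalRing

/-! ### Automorphisms of finite order of a local algebra -/

section

variable {k R : Type*} [Field k] [CommRing R] [IsLocalRing R] [Algebra k R] {σ : R →ₐ[k] R}

theorem sub_mem_sq_of_forall_mem_maximalIdeal
    (hres : ∀ a : R, ∃ c : k, a - algebraMap k R c ∈ maximalIdeal R)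
    (hσ : ∀ a ∈ maximalIdeal R, σ a - a ∈ maximalIdeal R ^ 2) (a : R) :
    σ a - a ∈ maximalIdeal R ^ 2 := by
  obtain ⟨c, hc⟩ := hres a
  have := hσ _ hc
  rwa [map_sub, AlgHom.commutes, sub_sub_sub_cancel_right] at this

/-- An endomorphism that is trivial modulo `𝔪²` is unipotent for the `𝔪`-adic filtration. -/
theorem sub_mem_pow_succ_of_mem_pow (hσ : ∀ a : R, σ a - a ∈ maximalIdeal R ^ 2) (j : ℕ) {a : R}
    (ha : a ∈ maximalIdeal R ^ j) : σ a - a ∈ maximalIdeal R ^ (j + 1) := by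
  induction j generalizing a with
  | zero => simpa using Ideal.pow_le_self two_ne_zero (hσ a)
  | succ j ih =>
    rw [pow_succ'] at ha
    refine Submodule.mul_induction_on ha (fun x hx y hy => ?_) (fun x y hx hy => ?_)
    · have hy' : σ y ∈ maximalIdeal R ^ j := by
        have := add_mem (Ideal.pow_le_pow_right j.le_succ (ih hy)) hy
        rwa [sub_add_cancel] at this
      have h1 : (σ x - x) * σ y ∈ maximalIdeal R ^ (j + 1 + 1) := by
        rw [show j + 1 + 1 = 2 + j by ring, pow_add]
        exact Ideal.mul_mem_mul (hσ x) hy'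
      have h2 : x * (σ y - y) ∈ maximalIdeal R ^ (j + 1 + 1) := by
        rw [pow_succ']
        exact Ideal.mul_mem_mul hx (ih hy)
      have : σ (x * y) - x * y = (σ x - x) * σ y + x * (σ y - y) := by
        rw [map_mul]; ring
      rw [this]
      exact add_mem h1 h2
    · rw [map_add, add_sub_add_comm]
      exact add_mem hx hy

/-- To first order beyond the depth `j` of `σ - 1`, iterating `σ` multiplies `σ - 1`:
`σⁿ - 1 ≡ n (σ - 1)` modulo `𝔪ʲ⁺¹`. -/
theorem iterate_sub_sub_mul_mem (hσ : ∀ a : R, σ a - a ∈ maximalIdeal R ^ 2) {j : ℕ}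
    (hj : ∀ a : R, σ a - a ∈ maximalIdeal R ^ j) (n : ℕ) (a : R) :
    σ^[n] a - a - n * (σ a - a) ∈ maximalIdeal R ^ (j + 1) := by
  induction n with
  | zero => simp
  | succ n ih =>
    have h1 : σ^[n] a - a ∈ maximalIdeal R ^ j := by
      have := add_mem (Ideal.pow_le_pow_right j.le_succ ih) (Ideal.mul_mem_left _ (n : R) (hj a))
      rwa [sub_add_cancel] at this
    have h2 := add_mem ih (sub_mem_pow_succ_of_mem_pow hσ j h1)
    rw [Function.iterate_succ_apply']
    convert h2 using 1
    rw [map_sub]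
    push_cast
    ring

/-- In characteristic zero, an automorphism of finite order that is trivial modulo `𝔪²` is trivial
modulo every power of `𝔪`, hence is the identity by Krull's intersection theorem. -/
theorem eq_id_of_iterate_eq_id [CharZero k] [IsNoetherianRing R]
    (hres : ∀ a : R, ∃ c : k, a - algebraMap k R c ∈ maximalIdeal R)
    (hσ : ∀ a ∈ maximalIdeal R, σ a - a ∈ maximalIdeal R ^ 2) {n : ℕ} (hn : n ≠ 0)
    (hord : ∀ a, σ^[n] a = a) (a : R) : σ a = a := by
  have h2 := sub_mem_sq_of_forall_mem_maximalIdeal hres hσ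
  have hunit : IsUnit (n : R) := by
    have := (IsUnit.mk0 (n : k) (Nat.cast_ne_zero.mpr hn)).map (algebraMap k R)
    rwa [map_natCast] at this
  have hall (j : ℕ) : ∀ a : R, σ a - a ∈ maximalIdeal R ^ j := by
    induction j with
    | zero => simp
    | succ j ih =>
      intro a
      have := iterate_sub_sub_mul_mem h2 ih n a
      rw [hord, sub_self, zero_sub, neg_mem_iff] at this
      exact (Ideal.unit_mul_mem_iff_mem _ hunit).mp this
  have : σ a - a ∈ ⨅ j : ℕ, maximalIdeal R ^ j := Ideal.mem_iInf.mpr fun j => hall j a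
  rw [Ideal.iInf_pow_eq_bot_of_isLocalRing _ (maximalIdeal.isMaximal R).ne_top] at this
  exact sub_eq_zero.mp this

/-- A faithful action of a finite group on a local `k`-algebra induces a faithful representation on
the cotangent space. -/
theorem exists_injective_cotangentSpace_representation [CharZero k] [IsNoetherianRing R]
    (hres : ∀ a : R, ∃ c : k, a - algebraMap k R c ∈ maximalIdeal R)
    {G : Type*} [Group G] [Finite G] (θ : G →* (R →ₐ[k] R)) (hθ : Function.Injective θ) :
    ∃ ρ : G →* Module.End k (CotangentSpace R), Function.Injective ρ := by
  have hle (g : G) : maximalIdeal R ≤ (maximalIdeal R).comap (θ g) := by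
    intro a ha hu
    refine ha ?_
    have h1 : θ g⁻¹ (θ g a) = a := by
      rw [← AlgHom.mul_apply, ← map_mul, inv_mul_cancel, map_one]; rfl
    exact h1 ▸ hu.map (θ g⁻¹)
  let ρ : G →* Module.End k (CotangentSpace R) :=
    { toFun g := Ideal.mapCotangent _ _ (θ g) (hle g)
      map_one' := by
        refine LinearMap.ext fun x => ?_
        obtain ⟨x, rfl⟩ := Ideal.toCotangent_surjective _ x
        rw [Ideal.mapCotangent_toCotangent]
        exact congrArg _ (Subtype.ext (by simp))
      map_mul' g h := by
        refine LinearMap.ext fun x => ?_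
        obtain ⟨x, rfl⟩ := Ideal.toCotangent_surjective _ x
        rw [Module.End.mul_apply]
        rw [Ideal.mapCotangent_toCotangent, Ideal.mapCotangent_toCotangent,
          Ideal.mapCotangent_toCotangent]
        exact congrArg _ (Subtype.ext (by simp)) }
  refine ⟨ρ, (injective_iff_map_eq_one _).mpr fun g hg => hθ ?_⟩
  rw [map_one]
  refine AlgHom.ext fun a => ?_
  refine eq_id_of_iterate_eq_id hres (fun a ha => ?_) (orderOf_pos g).ne' (fun a => ?_) a
  · have h1 : ρ g ((maximalIdeal R).toCotangent ⟨a, ha⟩) =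
        (maximalIdeal R).toCotangent ⟨a, ha⟩ := by
      rw [hg]; rfl
    exact (Ideal.toCotangent_eq _).mp
      ((Ideal.mapCotangent_toCotangent _ _ _ (hle g) _).symm.trans h1)
  · have h1 (n : ℕ) : (θ g)^[n] a = θ (g ^ n) a := by
      induction n with
      | zero => simp
      | succ n ih => rw [Function.iterate_succ_apply', ih, pow_succ', map_mul]; rfl
    rw [h1, pow_orderOf_eq_one, map_one]; rfl

/-- When `k` is the residue field, it does not matter over which of the two fields the dimension of
the cotangent space is taken. -/
theorem rank_cotangentSpace_eq_rank_residueField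
    (hres : ∀ a : R, ∃ c : k, a - algebraMap k R c ∈ maximalIdeal R) :
    Module.rank k (CotangentSpace R) = Module.rank (ResidueField R) (CotangentSpace R) := by
  have hbij : Function.Bijective (algebraMap k (ResidueField R)) := by
    refine ⟨(algebraMap k (ResidueField R)).injective, fun x => ?_⟩
    obtain ⟨a, rfl⟩ := residue_surjective x
    obtain ⟨c, hc⟩ := hres a
    refine ⟨c, ?_⟩
    rw [← residue_eq_zero_iff, map_sub, sub_eq_zero] at hc
    exact hc.symm
  refine rank_eq_of_equiv_equiv _ (AddEquiv.refl (CotangentSpace R)) hbij fun c x => ?_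
  change c • x = residue R (algebraMap k R c) • x
  rw [← ResidueField.algebraMap_eq, algebraMap_smul, algebraMap_smul]

theorem finrank_cotangentSpace_le_of_span [IsNoetherianRing R] {s : Set R} (hs : s.Finite)
    (h : Ideal.span s = maximalIdeal R) :
    Module.finrank (ResidueField R) (CotangentSpace R) ≤ s.ncard := by
  rw [← spanFinrank_maximalIdeal_eq_finrank_cotangentSpace, ← h]
  exact Submodule.spanFinrank_span_le_ncard_of_finite hs

end

/-- A faithful representation of dimension at most `d` becomes one of dimension exactly `d` by
adding a trivial summand. -/
theorem exists_injective_matrix_representation {k V : Type*} [Field k] [AddCommGroup V]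
    [Module k V] [FiniteDimensional k V] {G : Type*} [Group G] (ρ : G →* Module.End k V)
    (hρ : Function.Injective ρ) {d : ℕ} (hd : Module.finrank k V ≤ d) :
    ∃ τ : G →* Matrix (Fin d) (Fin d) k, Function.Injective τ := by
  have hW : Module.finrank k (V × (Fin (d - Module.finrank k V) → k)) = d := by
    rw [Module.finrank_prod, Module.finrank_fin_fun]
    omega
  let b := Module.finBasisOfFinrankEq k _ hW
  let ρ' : G →* Module.End k (V × (Fin (d - Module.finrank k V) → k)) :=
    { toFun g := (ρ g).prodMap LinearMap.id
      map_one' := by ext <;> simp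
      map_mul' g h := by ext <;> simp }
  refine ⟨(MonoidHomClass.toMonoidHom (LinearMap.toMatrixAlgEquiv b)).comp ρ', fun g h hgh => hρ ?_⟩
  have h1 : ρ' g = ρ' h := (LinearMap.toMatrixAlgEquiv b).injective hgh
  ext v
  exact congrArg Prod.fst (LinearMap.congr_fun h1 (v, 0))

/-! ### Boundedness of the dimensions of tangent spaces -/

/-- If `A` is generated over `k` by `a₁, …, aₙ` and the local ring `R` of `A` at a prime `p` has
residue field `k`, then `p`, and with it the maximal ideal of `R`, is generated by the `aᵢ - cᵢ`,
where `cᵢ ∈ k` is the value of `aᵢ`. -/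
theorem exists_span_eq_maximalIdeal_of_adjoin_eq_top {k A R : Type*} [Field k] [CommRing A]
    [Algebra k A] [CommRing R] [IsLocalRing R] [Algebra A R] [Algebra k R] [IsScalarTower k A R]
    (hres : ∀ a : R, ∃ c : k, a - algebraMap k R c ∈ maximalIdeal R)
    {s : Finset A} (hs : Algebra.adjoin k (s : Set A) = ⊤) (p : Ideal A) [p.IsPrime]
    [IsLocalization.AtPrime R p] :
    ∃ t : Set R, t.Finite ∧ t.ncard ≤ s.card ∧ Ideal.span t = maximalIdeal R := by
  choose c hc using fun a : A => hres (algebraMap A R a)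
  let q : A → A := fun a => a - algebraMap k A (c a)
  have hmem (a : A) : a ∈ p ↔ algebraMap A R a ∈ maximalIdeal R :=
    (IsLocalization.AtPrime.to_map_mem_maximal_iff R p a).symm
  have hq (a : A) : q a ∈ p := by
    rw [hmem, map_sub, ← IsScalarTower.algebraMap_apply k A R]
    exact hc a
  have hspan : Ideal.span (q '' s) = p := by
    refine le_antisymm (Ideal.span_le.mpr ?_) fun x hx => ?_
    · rintro _ ⟨a, -, rfl⟩
      exact hq a
    · have hle : Ideal.span (q '' s) ≤ p := Ideal.span_le.mpr (by rintro _ ⟨a, -, rfl⟩; exact hq a)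
      have key (x : A) : ∃ e : k, x - algebraMap k A e ∈ Ideal.span (q '' s) := by
        have hx : x ∈ Algebra.adjoin k (s : Set A) := hs ▸ Algebra.mem_top
        induction hx using Algebra.adjoin_induction with
        | mem a ha => exact ⟨c a, Ideal.subset_span ⟨a, ha, rfl⟩⟩
        | algebraMap e => exact ⟨e, by simp⟩
        | add x y _ _ hx hy =>
          obtain ⟨e, he⟩ := hx
          obtain ⟨f, hf⟩ := hy
          exact ⟨e + f, by rw [map_add, add_sub_add_comm]; exact add_mem he hf⟩
        | mul x y _ _ hx hy =>
          obtain ⟨e, he⟩ := hx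
          obtain ⟨f, hf⟩ := hy
          refine ⟨e * f, ?_⟩
          have : x * y - algebraMap k A (e * f) = y * (x - algebraMap k A e)
              + algebraMap k A e * (y - algebraMap k A f) := by rw [map_mul]; ring
          rw [this]
          exact add_mem (Ideal.mul_mem_left _ _ he) (Ideal.mul_mem_left _ _ hf)
      obtain ⟨e, he⟩ := key x
      have hep : algebraMap k A e ∈ p := by
        have := sub_mem hx (hle he)
        rwa [sub_sub_cancel] at this
      have he0 : e = 0 := by
        by_contra h
        exact ‹p.IsPrime›.ne_top (Ideal.eq_top_of_isUnit_mem _ hep ((IsUnit.mk0 e h).map _))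
      rwa [he0, map_zero, sub_zero] at he
  refine ⟨algebraMap A R '' (q '' s), (s.finite_toSet.image _).image _, ?_, ?_⟩
  · rw [← Set.ncard_coe_finset s, ← Set.image_comp]
    exact Set.ncard_image_le s.finite_toSet
  · rw [← Ideal.map_span, hspan, IsLocalization.AtPrime.map_eq_maximalIdeal p R]

section

variable {k : Type u} [Field k] (X : Over (Spec (CommRingCat.of k)))

/-- The structure map `k ⟶ 𝒪_{X, x}` of a `k`-scheme `X`. -/
noncomputable def stalkStructureMap (x : X.left) : CommRingCat.of k ⟶ X.left.presheaf.stalk x :=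
  Spec.preimage (X.left.fromSpecStalk x ≫ X.hom)

theorem SpecMap_stalkStructureMap (x : X.left) :
    Spec.map (stalkStructureMap X x) = X.left.fromSpecStalk x ≫ X.hom :=
  Spec.map_preimage _

variable {X} in
/-- The residue field at a closed point is `k`, by the Nullstellensatz. -/
theorem exists_sub_stalkStructureMap_mem_maximalIdeal [IsAlgClosed k] [LocallyOfFiniteType X.hom]
    {x : X.left} (hx : IsClosed {x}) (a : X.left.presheaf.stalk x) :
    ∃ c : k, a - (stalkStructureMap X x).hom c ∈ maximalIdeal (X.left.presheaf.stalk x) := by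
  have h : (residueFieldIsoBase X.hom x hx).inv = stalkStructureMap X x ≫ X.left.residue x := by
    apply Spec.map_injective
    rw [SpecMap_residueFieldIsoBase_inv, Spec.map_comp, SpecMap_stalkStructureMap,
      Scheme.fromSpecResidueField, Category.assoc]
  let b := (X.left.residue x).hom a
  refine ⟨(residueFieldIsoBase X.hom x hx).hom.hom b, ?_⟩
  rw [← residue_eq_zero_iff, map_sub, sub_eq_zero]
  have h1 : (residueFieldIsoBase X.hom x hx).inv.hom ((residueFieldIsoBase X.hom x hx).hom.hom b)
      = b := by
    have := (residueFieldIsoBase X.hom x hx).hom_inv_id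
    exact congrArg (fun f => f.hom b) this
  rw [h] at h1
  exact h1.symm

theorem tangentDim_eq_finrank_cotangentSpace (X : Scheme.{u}) (x : X) :
    tangentDim X x = Module.finrank (ResidueField (X.presheaf.stalk x))
      (CotangentSpace (X.presheaf.stalk x)) :=
  Subspace.dual_finrank_eq

variable {X} in
/-- The number of generators of the `k`-algebra of functions on an affine open set bounds the
dimensions of the tangent spaces at its closed points. -/
theorem exists_forall_tangentDim_le_of_isAffineOpen [IsAlgClosed k] [LocallyOfFiniteType X.hom]
    {U : X.left.Opens} (hU : IsAffineOpen U) :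
    ∃ N : ℕ, ∀ x ∈ U, IsClosed {x} → tangentDim X.left x ≤ N := by
  have : IsLocallyNoetherian X.left := LocallyOfFiniteType.isLocallyNoetherian X.hom
  let ψ : CommRingCat.of k ⟶ Γ(X.left, U) := Spec.preimage (hU.fromSpec ≫ X.hom)
  have hψ : Spec.map ψ = hU.fromSpec ≫ X.hom := Spec.map_preimage _
  have hft : ψ.hom.FiniteType := by
    rw [← HasRingHomProperty.Spec_iff (P := @LocallyOfFiniteType), hψ]
    infer_instance
  algebraize [ψ.hom]
  obtain ⟨s, hs⟩ := ‹Algebra.FiniteType k Γ(X.left, U)›.out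
  refine ⟨s.card, fun x hx hclosed => ?_⟩
  let : Algebra k (X.left.presheaf.stalk x) := (stalkStructureMap X x).hom.toAlgebra
  let : Algebra Γ(X.left, U) (X.left.presheaf.stalk x) :=
    (X.left.presheaf.germ U x hx).hom.toAlgebra
  have := hU.isLocalization_stalk ⟨x, hx⟩
  have hcomp : stalkStructureMap X x = ψ ≫ X.left.presheaf.germ U x hx := by
    apply Spec.map_injective
    rw [SpecMap_stalkStructureMap, Spec.map_comp, hψ, ← hU.fromSpecStalk_eq_fromSpecStalk hx,
      IsAffineOpen.fromSpecStalk, Category.assoc]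
  have : IsScalarTower k Γ(X.left, U) (X.left.presheaf.stalk x) :=
    .of_algebraMap_eq fun c => congrArg (fun f => f.hom c) hcomp
  obtain ⟨t, ht, hcard, hspan⟩ := exists_span_eq_maximalIdeal_of_adjoin_eq_top
    (exists_sub_stalkStructureMap_mem_maximalIdeal hclosed) hs
    (hU.primeIdealOf ⟨x, hx⟩).asIdeal
  rw [tangentDim_eq_finrank_cotangentSpace]
  exact (finrank_cotangentSpace_le_of_span ht hspan).trans hcard

variable {X} in
theorem bddAbove_tangentDim [IsAlgClosed k] [LocallyOfFiniteType X.hom] [QuasiCompact X.hom] :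
    BddAbove {n : ℕ | ∃ x : X.left, IsClosed ({x} : Set X.left) ∧ tangentDim X.left x = n} := by
  have : CompactSpace X.left := QuasiCompact.compactSpace_of_compactSpace X.hom
  have h : ∃ N : ℕ, ∀ x ∈ (Set.univ : Set X.left), IsClosed {x} → tangentDim X.left x ≤ N := by
    refine isCompact_univ.induction_on
      (p := fun s => ∃ N : ℕ, ∀ x ∈ s, IsClosed {x} → tangentDim X.left x ≤ N) ⟨0, by simp⟩ ?_ ?_ ?_
    · exact fun s t hst ⟨N, hN⟩ => ⟨N, fun x hx => hN x (hst hx)⟩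
    · rintro s t ⟨N, hN⟩ ⟨M, hM⟩
      refine ⟨max N M, fun x hx hclosed => ?_⟩
      rcases hx with hx | hx
      · exact (hN x hx hclosed).trans (le_max_left _ _)
      · exact (hM x hx hclosed).trans (le_max_right _ _)
    · intro x _
      obtain ⟨_, ⟨U, hU, rfl⟩, hxU, -⟩ :=
        X.left.isBasis_affineOpens.exists_subset_of_mem_open (Set.mem_univ x) isOpen_univ
      exact ⟨U, mem_nhdsWithin_of_mem_nhds (U.2.mem_nhds hxU),
        exists_forall_tangentDim_le_of_isAffineOpen hU⟩
  obtain ⟨N, hN⟩ := h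
  refine ⟨N, ?_⟩
  rintro _ ⟨x, hx, rfl⟩
  exact hN x trivial hx

end

/-! ### The action on the local ring at a fixed point -/

/-- A morphism fixing `x` acts on the local ring at `x`. The action is characterized through the
monomorphism `Spec 𝒪_{X, x} ⟶ X`, which avoids transporting stalks along `f x = x`. -/
theorem exists_SpecMap_comp_fromSpecStalk {X : Scheme.{u}} {f : X ⟶ X} {x : X} (hfx : f x = x) :
    ∃ σ : X.presheaf.stalk x ⟶ X.presheaf.stalk x,
      Spec.map σ ≫ X.fromSpecStalk x = X.fromSpecStalk x ≫ f := by
  refine ⟨X.presheaf.stalkSpecializes (specializes_of_eq hfx) ≫ f.stalkMap x, ?_⟩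
  rw [Spec.map_comp, Category.assoc, Scheme.SpecMap_stalkSpecializes_fromSpecStalk,
    Scheme.SpecMap_stalkMap_fromSpecStalk]

/-- The image of `Spec 𝒪_{X, x}` consists of the points specializing to `x`, hence contains the
generic point of every irreducible component through `x`. -/
theorem isDominant_fromSpecStalk_of_forall_mem_irreducibleComponents {X : Scheme.{u}} {x : X}
    (hx : ∀ Z ∈ irreducibleComponents X, x ∈ Z) : IsDominant (X.fromSpecStalk x) := by
  refine ⟨fun y => ?_⟩
  have hirr : IsIrreducible (irreducibleComponent y) := isIrreducible_irreducibleComponent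
  have hgen := hirr.isGenericPoint_genericPoint_closure
  rw [isClosed_irreducibleComponent.closure_eq] at hgen
  have hz : hirr.genericPoint ∈ Set.range (X.fromSpecStalk x) := by
    rw [Scheme.range_fromSpecStalk]
    exact hgen.specializes (hx _ (irreducibleComponent_mem_irreducibleComponents y))
  exact closure_mono (Set.singleton_subset_iff.mpr hz)
    (specializes_iff_mem_closure.mp (hgen.specializes mem_irreducibleComponent))

/-- A group of `k`-automorphisms fixing a point `x` on every irreducible component acts faithfully
on the local ring `𝒪_{X, x}`. Since pulling back functions reverses composition, `g` acts by
pullback along `g⁻¹`. -/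
theorem exists_injective_stalk_action {k : Type u} [Field k] {X : Over (Spec (CommRingCat.of k))}
    [IsReduced X.left] [IsSeparated X.hom] (G : Subgroup (Aut X)) {x : X.left}
    [Algebra k (X.left.presheaf.stalk x)]
    (halg : algebraMap k (X.left.presheaf.stalk x) = (stalkStructureMap X x).hom)
    (hfix : ∀ g ∈ G, g.hom.left x = x) (hx : ∀ Z ∈ irreducibleComponents X.left, x ∈ Z) :
    ∃ θ : G →* (X.left.presheaf.stalk x →ₐ[k] X.left.presheaf.stalk x), Function.Injective θ := by
  let ι := X.left.fromSpecStalk x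
  have : IsDominant ι := isDominant_fromSpecStalk_of_forall_mem_irreducibleComponents hx
  choose σ hσ using fun g : G => exists_SpecMap_comp_fromSpecStalk (hfix _ (g⁻¹).2)
  have huniq {α β : X.left.presheaf.stalk x ⟶ X.left.presheaf.stalk x}
      (h : Spec.map α ≫ ι = Spec.map β ≫ ι) : α = β :=
    Spec.map_injective ((cancel_mono ι).mp h)
  have hstruct (g : G) : stalkStructureMap X x ≫ σ g = stalkStructureMap X x := by
    apply Spec.map_injective
    rw [Spec.map_comp, SpecMap_stalkStructureMap, ← Category.assoc, hσ, Category.assoc, Over.w]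
  have hone : σ 1 = 𝟙 _ := huniq (by
    rw [hσ, Spec.map_id, Category.id_comp, inv_one]
    exact Category.comp_id _)
  have hmul (g h : G) : σ (g * h) = σ h ≫ σ g := huniq (by
    rw [Spec.map_comp, Category.assoc, hσ h, ← Category.assoc, hσ g, hσ, mul_inv_rev,
      Category.assoc]
    rfl)
  refine ⟨
    { toFun g :=
        { (σ g).hom with
          commutes' := fun c => by
            rw [halg]
            exact congrArg (fun f => f.hom c) (hstruct g) }
      map_one' := AlgHom.ext fun a => congrArg (fun f => f.hom a) hone
      map_mul' := fun g h => AlgHom.ext fun a => congrArg (fun f => f.hom a) (hmul g h) },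
    fun g h hgh => ?_⟩
  have hσgh : σ g = σ h := by
    ext a
    exact AlgHom.congr_fun hgh a
  have hleft : (g⁻¹).1.hom.left = (h⁻¹).1.hom.left := by
    refine ext_of_isDominant_of_isSeparated X.hom ?_ ι ?_
    · rw [Over.w, Over.w]
    · rw [← hσ, ← hσ, hσgh]
  have : (g⁻¹).1 = (h⁻¹).1 := Aut.ext (Over.OverMorphism.ext hleft)
  exact inv_injective (Subtype.ext this)

end

/-! ### The bound for finite automorphism groups with a fixed point -/

theorem mainTheorem4 {k : Type u} [Field k] [IsAlgClosed k] [CharZero k]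
    (X : Over (Spec (CommRingCat.of k))) (hX : IsAlgVariety X)
    (G : Subgroup (Aut X)) (hG : Finite G)
    (hfix : ∃ x ∈ fixedClosedPoints X G, ∀ Z ∈ irreducibleComponents X.left, x ∈ Z) :
    ∃ d : ℕ,
      IsGreatest {n : ℕ | ∃ x : X.left, IsClosed ({x} : Set X.left) ∧ tangentDim X.left x = n} d ∧
      IsJordanGroup (Matrix.GeneralLinearGroup (Fin d) k) ∧
      ∀ J : ℕ, IsJordanBound (Matrix.GeneralLinearGroup (Fin d) k) J →
        HasAbelianNormalSubgroupOfIndexLE G J := by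
  have := hX.isReduced
  have := hX.isSeparated
  have := hX.locallyOfFiniteType
  have := hX.quasiCompact
  have : IsLocallyNoetherian X.left := LocallyOfFiniteType.isLocallyNoetherian X.hom
  obtain ⟨x, ⟨hclosed, hfixed⟩, hcomp⟩ := hfix
  have hbdd := bddAbove_tangentDim (X := X)
  have hmem : tangentDim X.left x ∈
      {n : ℕ | ∃ x : X.left, IsClosed ({x} : Set X.left) ∧ tangentDim X.left x = n} :=
    ⟨x, hclosed, rfl⟩
  refine ⟨_, ⟨Nat.sSup_mem ⟨_, hmem⟩ hbdd, fun _ hn => le_csSup hbdd hn⟩,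
    isJordanGroup_generalLinearGroup k _, fun J hJ => ?_⟩
  let : Algebra k (X.left.presheaf.stalk x) := (stalkStructureMap X x).hom.toAlgebra
  have hres (a : X.left.presheaf.stalk x) :
      ∃ c : k, a - algebraMap k _ c ∈ IsLocalRing.maximalIdeal (X.left.presheaf.stalk x) :=
    exists_sub_stalkStructureMap_mem_maximalIdeal hclosed a
  have hrank := rank_cotangentSpace_eq_rank_residueField hres
  have : FiniteDimensional k (IsLocalRing.CotangentSpace (X.left.presheaf.stalk x)) := by
    rw [FiniteDimensional, ← Module.rank_lt_aleph0_iff, hrank]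
    exact Module.rank_lt_aleph0 _ _
  obtain ⟨θ, hθ⟩ := exists_injective_stalk_action G rfl hfixed hcomp
  obtain ⟨ρ, hρ⟩ := exists_injective_cotangentSpace_representation hres θ hθ
  have hdim : Module.finrank k (IsLocalRing.CotangentSpace (X.left.presheaf.stalk x)) =
      tangentDim X.left x := by
    rw [tangentDim_eq_finrank_cotangentSpace, Module.finrank, Module.finrank, hrank]
  obtain ⟨τ, hτ⟩ := exists_injective_matrix_representation ρ hρ (hdim.trans_le (le_csSup hbdd hmem))
  exact hJ.of_injective_matrix τ hτ
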